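/- All graphs are finite and simple. A graph $G=(V,E)$ is a \emph{unit disk graph} if there is a map $\phi:V\to\mathbb{R}^2$ such that, for all distinct $x,y\in V$, $xy\in E$ if and only if $\|\phi(x)-\phi(y)\|_2<2$. A \emph{graph class} is a set of (labeled) graphs closed under isomorphism. The \emph{chain-index} $\mathrm{ch}(G)$ is the largest $k$ for which there are disjoint sets of vertices $\{a_1,\dots,a_k\}$ and $\{b_1,\dots,b_k\}$ (each of size $k$) such that for all $i<j$, $a_i$ and $b_j$ are adjacent but $b_i$ and $a_j$ are not; $\mathcal{G}$ is \emph{stable} if there is a constant $k$ with $\mathrm{ch}(G)\le k$ for all $G\in\mathcal{G}$. Let $\mathsf{QS}(\textsc{Eq})$ be the closure of the set of all identity matrices $I_{N\times N}$, $N\in\mathbb{N}$, viewed as $\pm1$ matrices with $1$ on the diagonal and $-1$ elsewhere, under row and column permutations, taking submatrices, and duplicating rows or columns. For $P\in\{\pm1\}^{N\times N}$, a \emph{deterministic protocol computing $P$ with $\textsc{Eq}$ oracles} is a rooted binary tree whose leaves $\ell$ carry values $b(\ell)\in\{\pm1\}$ and whose inner nodes $v$ carry $N\times N$ matrices $Q_v\in\mathsf{QS}(\textsc{Eq})$,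 such that for all $x,y\in[N]$ the path which starts at the root and moves from an inner node $v$ to its left child if $Q_v(x,y)=-1$ and to its right child if $Q_v(x,y)=1$ ends in a leaf $\ell$ with $b(\ell)=P(x,y)$. Its cost is the depth of the tree, and $\mathsf{D}^{\textsc{Eq}}(P)$ is the minimum cost of such a protocol. For a graph class $\mathcal{G}$, $\mathsf{D}^{\textsc{Eq}}(\mathcal{G})$ is the function mapping $N$ to the maximum of $\mathsf{D}^{\textsc{Eq}}(\mathrm{Adj}_G)$ over the $N$-vertex graphs $G\in\mathcal{G}$ (and to $0$ if there are none), where $\mathrm{Adj}_G\in\{\pm1\}^{V\times V}$ has $\mathrm{Adj}_G(x,y)=1$ if and only if $xy\in E$. We write $\mathsf{D}^{\textsc{Eq}}(\mathcal{G})=O(1)$ if this function is bounded by a constant. \textbf{Theorem.} Let $\mathcal{G}$ be a graph class all of whose members are unit disk graphs. Then $\mathsf{D}^{\textsc{Eq}}(\mathcal{G})=O(1)$ if and only if $\mathcal{G}$ is stable. -/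

import Mathlib

namespace UnitDiskComm

/-! ### Graphs and graph classes -/

/-- A class of finite (labeled) graphs: a set of graphs on the vertex sets `Fin n`, `n ∈ ℕ`,
which is closed under isomorphism. -/
structure GraphClass where
  graphs : (n : ℕ) → Set (SimpleGraph (Fin n))
  iso_closed : ∀ {n : ℕ} {G H : SimpleGraph (Fin n)}, Nonempty (G ≃g H) →
    G ∈ graphs n → H ∈ graphs n

/-- A graph is a unit disk graph if its vertices can be mapped to points of the Euclidean plane
so that distinct vertices are adjacent iff their points are at distance less than `2`. -/
def IsUnitDisk {V : Type*} (G : SimpleGraph V) : Prop :=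
  ∃ φ : V → EuclideanSpace ℝ (Fin 2), ∀ x y : V, x ≠ y → (G.Adj x y ↔ ‖φ x - φ y‖ < 2)

/-- There are two disjoint sets `{a₁, …, aₖ}`, `{b₁, …, bₖ}` of `k` vertices each such that, for
all `i < j`, `aᵢ` is adjacent to `bⱼ` and `bᵢ` is not adjacent to `aⱼ`. -/
def HasChain {V : Type*} (G : SimpleGraph V) (k : ℕ) : Prop :=
  ∃ a b : Fin k → V, Function.Injective a ∧ Function.Injective b ∧
    Disjoint (Set.range a) (Set.range b) ∧
    ∀ i j : Fin k, i < j → G.Adj (a i) (b j) ∧ ¬ G.Adj (b i) (a j)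

/-- The chain-index: the largest `k` for which `HasChain G k` holds. -/
noncomputable def chainIndex {V : Type*} [Finite V] (G : SimpleGraph V) : ℕ :=
  sSup {k : ℕ | HasChain G k}

theorem hasChain_zero {V : Type*} (G : SimpleGraph V) : HasChain G 0 :=
  ⟨Fin.elim0, Fin.elim0, fun i => i.elim0, fun i => i.elim0, by simp, fun i => i.elim0⟩

/-- The set whose supremum is the chain-index is bounded, so that the supremum is a maximum. -/
theorem bddAbove_hasChain {V : Type*} [Finite V] (G : SimpleGraph V) :
    BddAbove {k : ℕ | HasChain G k} := by
  refine ⟨Nat.card V, ?_⟩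
  rintro k ⟨a, -, ha, -⟩
  simpa using Nat.card_le_card_of_injective a ha

theorem hasChain_chainIndex {V : Type*} [Finite V] (G : SimpleGraph V) :
    HasChain G (chainIndex G) :=
  Nat.sSup_mem ⟨0, hasChain_zero G⟩ (bddAbove_hasChain G)

/-- A graph class is stable if the chain-index of its members is bounded by a constant. -/
def GraphClass.Stable (𝒢 : GraphClass) : Prop :=
  ∃ k : ℕ, ∀ n : ℕ, ∀ G ∈ 𝒢.graphs n, chainIndex G ≤ k

/-! ### Communication problems

Entries in `{±1}` are units of `ℤ`. -/

/-- An `m × n` matrix with entries in `{±1}`. -/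
abbrev SignMatrix (m n : ℕ) : Type := Matrix (Fin m) (Fin n) ℤˣ

/-- A communication problem: for each `N` a (necessarily finite) set of `N × N` sign matrices. -/
abbrev CommProblem : Type := (N : ℕ) → Set (SignMatrix N N)

/-- The adjacency matrix of a graph, with entry `1` at adjacent pairs and `-1` elsewhere. -/
noncomputable def adj {n : ℕ} (G : SimpleGraph (Fin n)) : SignMatrix n n :=
  open Classical in Matrix.of fun x y => if G.Adj x y then 1 else -1

/-- The communication problem of a graph class: the set of adjacency matrices of its members. -/
def GraphClass.problem (𝒢 : GraphClass) : CommProblem :=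
  fun N => {M | ∃ G ∈ 𝒢.graphs N, M = adj G}

/-- The Equality problem: the identity matrices, `1` on the diagonal and `-1` (false) elsewhere. -/
def equality : CommProblem :=
  fun N => {Matrix.of fun x y : Fin N => if x = y then 1 else -1}

/-- `QuerySet ℬ m n Q`: the `m × n` matrix `Q` belongs to the closure of `ℬ` under permuting rows
and columns, passing to submatrices, and duplicating a row or a column. -/
inductive QuerySet (ℬ : CommProblem) : (m n : ℕ) → SignMatrix m n → Prop
  | base {N : ℕ} {Q : SignMatrix N N} (hQ : Q ∈ ℬ N) : QuerySet ℬ N N Q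
  | perm {m n : ℕ} {Q : SignMatrix m n} (hQ : QuerySet ℬ m n Q)
      (σ : Equiv.Perm (Fin m)) (τ : Equiv.Perm (Fin n)) : QuerySet ℬ m n (Q.submatrix σ τ)
  | sub {m n m' n' : ℕ} {Q : SignMatrix m n} (hQ : QuerySet ℬ m n Q)
      (f : Fin m' ↪o Fin m) (g : Fin n' ↪o Fin n) : QuerySet ℬ m' n' (Q.submatrix f g)
  | dupRow {m n : ℕ} {Q : SignMatrix m n} (hQ : QuerySet ℬ m n Q) (i : Fin m) :
      QuerySet ℬ (m + 1) n (Q.submatrix (Fin.cons i id : Fin (m + 1) → Fin m) id)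
  | dupCol {m n : ℕ} {Q : SignMatrix m n} (hQ : QuerySet ℬ m n Q) (j : Fin n) :
      QuerySet ℬ m (n + 1) (Q.submatrix id (Fin.cons j id : Fin (n + 1) → Fin n))

/-- A deterministic protocol on inputs from `Fin N × Fin N` with `ℬ` oracles: a rooted binary tree
whose leaves carry output values and whose inner nodes carry `N × N` query matrices. -/
inductive Protocol (ℬ : CommProblem) (N : ℕ) : Type
  | leaf (b : ℤˣ) : Protocol ℬ N
  | node (Q : SignMatrix N N) (hQ : QuerySet ℬ N N Q) (left right : Protocol ℬ N) : Protocol ℬ N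

/-- The output of a protocol on the input pair `(x, y)`. -/
def Protocol.output {ℬ : CommProblem} {N : ℕ} : Protocol ℬ N → Fin N → Fin N → ℤˣ
  | .leaf b, _, _ => b
  | .node Q _ left right, x, y => if Q x y = -1 then left.output x y else right.output x y

/-- The cost of a protocol: the depth of the tree. -/
def Protocol.cost {ℬ : CommProblem} {N : ℕ} : Protocol ℬ N → ℕ
  | .leaf _ => 0
  | .node _ _ left right => max left.cost right.cost + 1

/-- The protocol outputs `P x y` on every input pair `(x, y)`. -/
def Protocol.Computes {ℬ : CommProblem} {N : ℕ} (T : Protocol ℬ N) (P : SignMatrix N N) : Prop :=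
  ∀ x y : Fin N, T.output x y = P x y

/-- `D^ℬ(P)`: the minimum cost of a protocol with `ℬ` oracles which computes `P`
(`⊤` if there is none). -/
noncomputable def oracleCost (ℬ : CommProblem) {N : ℕ} (P : SignMatrix N N) : ℕ∞ :=
  ⨅ T : {T : Protocol ℬ N // T.Computes P}, (T.1.cost : ℕ∞)

/-- `D^ℬ(𝒜)`: the function `N ↦ max_{P ∈ 𝒜_N} D^ℬ(P)`. -/
noncomputable def oracleCostFun (ℬ 𝒜 : CommProblem) (N : ℕ) : ℕ∞ :=
  ⨆ P ∈ 𝒜 N, oracleCost ℬ P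

/-- `D^ℬ(𝒜) = O(1)`: the function `D^ℬ(𝒜)` is bounded by a constant. -/
def ConstantCost (ℬ 𝒜 : CommProblem) : Prop :=
  ∃ c : ℕ, ∀ N : ℕ, oracleCostFun ℬ 𝒜 N ≤ c

end UnitDiskComm

/-!
A protocol with equality oracles is a decision tree whose nodes ask whether a label of `x` equals a
label of `y` (`EqTree`), because the query matrices are exactly those of the form `f x = g y`
(`querySet_equality_of_labels`, `QuerySet.exists_labels`).

*Constant cost implies stability.* A single query `f x = g y` is constant off the diagonal of a
large principal submatrix (`exists_subset_labels_const`): if a fibre of `f` or `g` is large, this is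
the pigeonhole principle, and otherwise a greedy choice avoids all coincidences. So a protocol of
bounded cost is constant off the diagonal of some submatrix of any sufficiently large chain, which
is absurd.

*Stability implies constant cost.* Cut the plane into unit squares. Equality queries find the
relative position of the squares of two points; points in the same square are adjacent, and squares
further than two rows or columns apart contain no adjacent points. There remain pairs of points on
two different rows (or columns) of squares. The upper arcs of two circles of radius `2` cross at
most once, so in the drawing on two lines by horizontal coordinates, two
crossing edges force one of the two non-crossing pairs of their endpoints to be an edge
(`dist_lt_of_crossing`). This property defines `CrossingBigraph`; it is inherited by induced
subgraphs and by the bipartite complement.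

For crossing-closed bipartite graphs the proof is by induction on the maximal length of a ladder, a
half graph written as one alternating sequence (`CrossingBigraph.treeBound`). Choose in each
component the leftmost vertex of one side as a root and split the vertices by their distance from
it. Equality queries find out whether two vertices are in the same component on consecutive levels,
so it suffices to treat two consecutive levels. Let `u` be the rightmost vertex of the upper one
and `p` its parent. For every edge `xy` between these levels, the path from `u` to the root has to
get from the right of `xy` to the left, which forces `x` to be adjacent to `p` or `y` to `u`
(`Levels.adj_parent_or_adj`). If `x` is restricted to neighbours of `p`, then `p` and its own parent
extend every ladder; if `x` is restricted to non-neighbours of `p` and `y` to neighbours of `u`,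
then `u` and `p` do (`TreeBound.consecutive_levels`). Both parts thus have shorter ladders. Next to
the root the parent of `p` is missing, but the root still extends all ladders that start on the
side of its neighbours. There, the same decomposition is applied to the bipartite complement, with
roots on the other side: this time the new root extends the remaining ladders
(`TreeBound.succ`).
-/

namespace UnitDiskComm

/-! ### Decision trees of equality queries -/

/-- `EqTree c D R`: on the pairs `(x, y)` with `D x y`, the relation `R` is decided by a decision
tree of depth `c` which at each node compares a label of `x` with a label of `y`. Carrying the
domain `D` along lets each subtree be responsible for only the pairs that reach it. -/
def EqTree {X Y : Type} : ℕ → (X → Y → Prop) → (X → Y → Prop) → Prop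
  | 0, D, R => (∀ x y, D x y → R x y) ∨ (∀ x y, D x y → ¬ R x y)
  | c + 1, D, R => ∃ (L : Type) (f : X → L) (g : Y → L),
      EqTree c (fun x y => D x y ∧ f x = g y) R ∧ EqTree c (fun x y => D x y ∧ f x ≠ g y) R

namespace EqTree

variable {X Y : Type} {c c' : ℕ} {D D' R R' : X → Y → Prop}

theorem congr (h : EqTree c D R) (hD : ∀ x y, D' x y → D x y)
    (hR : ∀ x y, D' x y → (R' x y ↔ R x y)) : EqTree c D' R' := by
  induction c generalizing D D' with
  | zero =>
    exact h.imp (fun h x y hx => (hR x y hx).2 (h x y (hD x y hx)))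
      (fun h x y hx hR' => h x y (hD x y hx) ((hR x y hx).1 hR'))
  | succ c ih =>
    obtain ⟨L, f, g, h1, h2⟩ := h
    exact ⟨L, f, g, ih h1 (fun x y h => ⟨hD x y h.1, h.2⟩) (fun x y h => hR x y h.1),
      ih h2 (fun x y h => ⟨hD x y h.1, h.2⟩) (fun x y h => hR x y h.1)⟩

theorem mono_domain (h : EqTree c D R) (hD : ∀ x y, D' x y → D x y) : EqTree c D' R :=
  h.congr hD fun _ _ _ => Iff.rfl

theorem succ (h : EqTree c D R) : EqTree (c + 1) D R :=
  ⟨Unit, fun _ => (), fun _ => (), h.mono_domain fun _ _ h => h.1, h.mono_domain fun _ _ h => h.1⟩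

theorem mono (h : EqTree c D R) (hc : c ≤ c') : EqTree c' D R :=
  Nat.le_induction h (fun _ _ h => h.succ) c' hc

theorem of_forall (h : ∀ x y, D x y → R x y) : EqTree c D R :=
  EqTree.mono (c := 0) (Or.inl h) (Nat.zero_le c)

theorem of_forall_not (h : ∀ x y, D x y → ¬ R x y) : EqTree c D R :=
  EqTree.mono (c := 0) (Or.inr h) (Nat.zero_le c)

theorem neg (h : EqTree c D R) : EqTree c D (fun x y => ¬ R x y) := by
  induction c generalizing D with
  | zero => exact h.symm.imp id (fun h x y hx => not_not.2 (h x y hx))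
  | succ c ih =>
    obtain ⟨L, f, g, h1, h2⟩ := h
    exact ⟨L, f, g, ih h1, ih h2⟩

theorem swap (h : EqTree c D R) : EqTree c (fun y x => D x y) (fun y x => R x y) := by
  induction c generalizing D with
  | zero => exact h.imp (fun h y x => h x y) (fun h y x => h x y)
  | succ c ih =>
    obtain ⟨L, f, g, h1, h2⟩ := h
    exact ⟨L, g, f, (ih h1).mono_domain fun _ _ h => ⟨h.1, h.2.symm⟩,
      (ih h2).mono_domain fun _ _ h => ⟨h.1, h.2.symm⟩⟩

theorem of_left (P : X → Prop) (h1 : EqTree c (fun x y => D x y ∧ P x) R)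
    (h2 : EqTree c (fun x y => D x y ∧ ¬ P x) R) : EqTree (c + 1) D R :=
  ⟨Prop, P, fun _ => True, h1.mono_domain fun _ _ h => ⟨h.1, of_eq_true h.2⟩,
    h2.mono_domain fun _ _ h => ⟨h.1, fun hP => h.2 (eq_true hP)⟩⟩

theorem of_right (P : Y → Prop) (h1 : EqTree c (fun x y => D x y ∧ P y) R)
    (h2 : EqTree c (fun x y => D x y ∧ ¬ P y) R) : EqTree (c + 1) D R :=
  (of_left (D := fun y x => D x y) (R := fun y x => R x y) P h1.swap h2.swap).swap

/-- Trees for the blocks `κ x = t = l y` merge into one tree on all pairs with `κ x = l y`: at each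
node the labels of the block of `x` are compared together with the name of that block, so that a
single query serves all blocks at once. -/
theorem of_blocks {K : Type} (κ : X → K) (l : Y → K)
    (h : ∀ t, EqTree c (fun x y => D x y ∧ κ x = t ∧ l y = t) R) :
    EqTree (c + 1) (fun x y => D x y ∧ κ x = l y) R := by
  classical
  induction c generalizing D with
  | zero =>
    -- Rows of a block on which `R` is false receive a label that no column has.
    let b : K → Prop := fun t => ∀ x y, (D x y ∧ κ x = t ∧ l y = t) → R x y
    refine ⟨Option K, fun x => if b (κ x) then some (κ x) else none, fun y => some (l y),
      Or.inl ?_, Or.inr ?_⟩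
    · rintro x y ⟨⟨hD, hκ⟩, hf⟩
      by_cases hb : b (κ x)
      · exact hb x y ⟨hD, rfl, hκ.symm⟩
      · simp [hb] at hf
    · rintro x y ⟨⟨hD, hκ⟩, hf⟩
      have hb : ¬ b (κ x) := fun hb => hf ((if_pos hb).trans (congrArg some hκ))
      rcases h (κ x) with h | h
      · exact absurd h hb
      · exact h x y ⟨hD, rfl, hκ.symm⟩
  | succ c ih =>
    choose L f g h1 h2 using h
    refine ⟨Σ t, L t, fun x => ⟨κ x, f (κ x) x⟩, fun y => ⟨l y, g (l y) y⟩, ?_, ?_⟩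
    · have := ih (D := fun x y => D x y ∧
          ((⟨κ x, f (κ x) x⟩ : Σ t, L t) = ⟨l y, g (l y) y⟩)) (fun t =>
          (h1 t).mono_domain (by
            rintro x y ⟨⟨hD, he⟩, rfl, hl⟩
            refine ⟨⟨hD, rfl, hl⟩, ?_⟩
            rw [hl] at he
            simpa using he))
      exact this.mono_domain fun x y h => ⟨⟨h.1.1, h.2⟩, h.1.2⟩
    · have := ih (D := fun x y => D x y ∧
          ((⟨κ x, f (κ x) x⟩ : Σ t, L t) ≠ ⟨l y, g (l y) y⟩)) (fun t =>
          (h2 t).mono_domain (by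
            rintro x y ⟨⟨hD, he⟩, rfl, hl⟩
            refine ⟨⟨hD, rfl, hl⟩, ?_⟩
            rw [hl] at he
            simpa using he))
      exact this.mono_domain fun x y h => ⟨⟨h.1.1, h.2⟩, h.1.2⟩

/-- As `of_blocks`, when the block of `y` is at one of finitely many offsets from that of `x`. -/
theorem of_offsets (κ l : X → ℤ) (ks : List ℤ) {D R : X → X → Prop}
    (h : ∀ k ∈ ks, ∀ t, EqTree c (fun x y => D x y ∧ κ x = t ∧ l y = t + k) R)
    (hR : ∀ x y, D x y → R x y → ∃ k ∈ ks, l y = κ x + k) : EqTree (c + 1 + ks.length) D R := by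
  induction ks generalizing D with
  | nil => exact of_forall_not fun x y hD hxy => by simpa using hR x y hD hxy
  | cons k ks ih =>
    refine ⟨ℤ, κ, fun y => l y - k, ?_, ?_⟩
    · refine (of_blocks κ (fun y => l y - k) fun t => (h k (by simp) t).mono_domain ?_).mono
        (by simp)
      rintro x y ⟨hD, hx, hy⟩
      exact ⟨hD, hx, by omega⟩
    · refine ih (fun k' hk' t => (h k' (by simp [hk']) t).mono_domain ?_) ?_
      · rintro x y ⟨⟨hD, -⟩, hx, hy⟩
        exact ⟨hD, hx, hy⟩
      · rintro x y ⟨hD, hne⟩ hxy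
        obtain ⟨k', hk', he⟩ := hR x y hD hxy
        rcases List.mem_cons.1 hk' with rfl | hk'
        · exact absurd (eq_sub_of_add_eq he.symm) hne
        · exact ⟨k', hk', he⟩

theorem of_subtype {V : Type} {S : Set V} {D R : V → V → Prop} (hD : ∀ x y, D x y → x ∈ S ∧ y ∈ S)
    (h : EqTree c (fun x y : S => D x y) (fun x y : S => R x y)) : EqTree c D R := by
  classical
  induction c generalizing D with
  | zero =>
    exact h.imp (fun h x y hxy => h ⟨x, (hD x y hxy).1⟩ ⟨y, (hD x y hxy).2⟩ hxy)
      (fun h x y hxy => h ⟨x, (hD x y hxy).1⟩ ⟨y, (hD x y hxy).2⟩ hxy)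
  | succ c ih =>
    obtain ⟨L, f, g, h1, h2⟩ := h
    refine ⟨Option L, fun x => if hx : x ∈ S then some (f ⟨x, hx⟩) else none,
      fun x => if hx : x ∈ S then some (g ⟨x, hx⟩) else none, ih ?_ ?_, ih ?_ ?_⟩
    · exact fun x y h => hD x y h.1
    · exact h1.mono_domain fun x y h => ⟨h.1, by simpa using h.2⟩
    · exact fun x y h => hD x y h.1
    · exact h2.mono_domain fun x y h => ⟨h.1, by simpa using h.2⟩

end EqTree

/-! ### Query matrices of the equality oracle -/

theorem QuerySet.submatrix_left {ℬ : CommProblem} {m n m' : ℕ} {Q : SignMatrix m n}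
    (hQ : QuerySet ℬ m n Q) (f : Fin m' → Fin m) : QuerySet ℬ m' n (Q.submatrix f id) := by
  -- The rows selected by `f` are put in front of all rows one at a time, by duplication.
  have key : ∃ (M : ℕ) (F : Fin M → Fin m) (e : Fin m' ↪o Fin M) (e' : Fin m → Fin M),
      QuerySet ℬ M n (Q.submatrix F id) ∧ (∀ i, F (e i) = f i) ∧ ∀ i, F (e' i) = i := by
    induction m' with
    | zero =>
      exact ⟨m, id, OrderEmbedding.ofStrictMono Fin.elim0 (fun i => i.elim0), id, hQ,
        fun i => i.elim0, fun i => rfl⟩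
    | succ k ih =>
      obtain ⟨M, F, e, e', hM, hF, hF'⟩ := ih (fun i => f i.succ)
      refine ⟨M + 1, F ∘ (Fin.cons (e' (f 0)) id : Fin (M + 1) → Fin M),
        OrderEmbedding.ofStrictMono (Fin.cons 0 fun i => (e i).succ) ?_, fun i => (e' i).succ,
        hM.dupRow _, ?_, ?_⟩
      · intro i j
        refine Fin.cases ?_ (fun i => ?_) i <;> refine Fin.cases ?_ (fun j => ?_) j <;> simp
      · intro i
        refine Fin.cases ?_ (fun i => ?_) i
        · exact hF' (f 0)
        · exact hF i
      · intro i
        simp [hF']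
  obtain ⟨M, F, e, -, hM, hF, -⟩ := key
  have := hM.sub e (OrderEmbedding.ofStrictMono id strictMono_id)
  convert this using 1
  ext i j
  simp [hF]

theorem QuerySet.submatrix_right {ℬ : CommProblem} {m n n' : ℕ} {Q : SignMatrix m n}
    (hQ : QuerySet ℬ m n Q) (f : Fin n' → Fin n) : QuerySet ℬ m n' (Q.submatrix id f) := by
  have key : ∃ (M : ℕ) (F : Fin M → Fin n) (e : Fin n' ↪o Fin M) (e' : Fin n → Fin M),
      QuerySet ℬ m M (Q.submatrix id F) ∧ (∀ i, F (e i) = f i) ∧ ∀ i, F (e' i) = i := by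
    induction n' with
    | zero =>
      exact ⟨n, id, OrderEmbedding.ofStrictMono Fin.elim0 (fun i => i.elim0), id, hQ,
        fun i => i.elim0, fun i => rfl⟩
    | succ k ih =>
      obtain ⟨M, F, e, e', hM, hF, hF'⟩ := ih (fun i => f i.succ)
      refine ⟨M + 1, F ∘ (Fin.cons (e' (f 0)) id : Fin (M + 1) → Fin M),
        OrderEmbedding.ofStrictMono (Fin.cons 0 fun i => (e i).succ) ?_, fun i => (e' i).succ,
        hM.dupCol _, ?_, ?_⟩
      · intro i j
        refine Fin.cases ?_ (fun i => ?_) i <;> refine Fin.cases ?_ (fun j => ?_) j <;> simp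
      · intro i
        refine Fin.cases ?_ (fun i => ?_) i
        · exact hF' (f 0)
        · exact hF i
      · intro i
        simp [hF']
  obtain ⟨M, F, e, -, hM, hF, -⟩ := key
  have := hM.sub (OrderEmbedding.ofStrictMono id strictMono_id) e
  convert this using 1
  ext i j
  simp [hF]

open Classical in
theorem querySet_equality_of_labels {N : ℕ} {L : Type} (f g : Fin N → L) :
    QuerySet equality N N (Matrix.of fun x y => if f x = g y then 1 else -1) := by
  have : Finite ↥(Set.range f ∪ Set.range g) := (Set.finite_range f).union (Set.finite_range g)
  let e := Finite.equivFin ↥(Set.range f ∪ Set.range g)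
  have hf : ∀ x, f x ∈ Set.range f ∪ Set.range g := fun x => Or.inl (Set.mem_range_self x)
  have hg : ∀ y, g y ∈ Set.range f ∪ Set.range g := fun y => Or.inr (Set.mem_range_self y)
  have hb : QuerySet equality _ _ _ :=
    .base (N := Nat.card ↥(Set.range f ∪ Set.range g)) (Set.mem_singleton _)
  convert (hb.submatrix_left fun x => e ⟨f x, hf x⟩).submatrix_right fun y => e ⟨g y, hg y⟩ using 1
  refine Matrix.ext fun x y => ?_
  have he : e ⟨f x, hf x⟩ = e ⟨g y, hg y⟩ ↔ f x = g y := by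
    rw [e.injective.eq_iff, Subtype.mk.injEq]
  change (if f x = g y then (1 : ℤˣ) else -1) = if e ⟨f x, hf x⟩ = e ⟨g y, hg y⟩ then 1 else -1
  by_cases h : f x = g y
  · rw [if_pos h, if_pos (he.2 h)]
  · rw [if_neg h, if_neg fun h' => h (he.1 h')]

theorem QuerySet.exists_labels {m n : ℕ} {Q : SignMatrix m n} (hQ : QuerySet equality m n Q) :
    ∃ (f : Fin m → ℕ) (g : Fin n → ℕ), ∀ x y, Q x y = -1 ↔ f x ≠ g y := by
  induction hQ with
  | @base N Q hQ =>
    refine ⟨fun x => x, fun y => y, fun x y => ?_⟩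
    rw [Set.mem_singleton_iff.1 hQ]
    by_cases h : x = y <;> simp [h, Fin.val_inj]
  | perm _ σ τ ih =>
    obtain ⟨f, g, h⟩ := ih
    exact ⟨f ∘ σ, g ∘ τ, fun x y => h _ _⟩
  | sub _ i j ih =>
    obtain ⟨f, g, h⟩ := ih
    exact ⟨f ∘ i, g ∘ j, fun x y => h _ _⟩
  | dupRow _ i ih =>
    obtain ⟨f, g, h⟩ := ih
    exact ⟨_, g, fun x y => h _ _⟩
  | dupCol _ j ih =>
    obtain ⟨f, g, h⟩ := ih
    exact ⟨f, _, fun x y => h _ _⟩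

open Classical in
theorem EqTree.exists_protocol {N c : ℕ} {D R : Fin N → Fin N → Prop} (h : EqTree c D R) :
    ∃ T : Protocol equality N, T.cost ≤ c ∧
      ∀ x y, D x y → T.output x y = if R x y then 1 else -1 := by
  induction c generalizing D with
  | zero =>
    rcases h with h | h
    · exact ⟨.leaf 1, le_rfl, fun x y hx => by simp [h x y hx, Protocol.output]⟩
    · exact ⟨.leaf (-1), le_rfl, fun x y hx => by simp [h x y hx, Protocol.output]⟩
  | succ c ih =>
    obtain ⟨L, f, g, h1, h2⟩ := h
    obtain ⟨T1, hc1, hT1⟩ := ih h1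
    obtain ⟨T2, hc2, hT2⟩ := ih h2
    refine ⟨.node _ (querySet_equality_of_labels f g) T2 T1, ?_, fun x y hx => ?_⟩
    · simp [Protocol.cost, hc1, hc2]
    · by_cases hfg : f x = g y
      · simpa [Protocol.output, hfg] using hT1 x y ⟨hx, hfg⟩
      · simpa [Protocol.output, hfg] using hT2 x y ⟨hx, hfg⟩

/-! ### Constant cost implies stability -/

/-- Greedy choice of an independent set in a graph of bounded degree. -/
theorem exists_independent_subset {ι : Type*} [DecidableEq ι] (C : ι → ι → Prop) (d n : ℕ)
    (S : Finset ι) (hS : (d + 1) * n ≤ S.card)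
    (hC : ∀ i ∈ S, ∃ B : Finset ι, B.card ≤ d ∧ ∀ j ∈ S, (C i j ∨ C j i) → j ∈ B) :
    ∃ S' ⊆ S, n ≤ S'.card ∧ ∀ i ∈ S', ∀ j ∈ S', i ≠ j → ¬ C i j := by
  induction n generalizing S with
  | zero => exact ⟨∅, by simp, by simp, by simp⟩
  | succ n ih =>
    have hne : S.Nonempty := by
      rw [← Finset.card_pos]
      exact lt_of_lt_of_le (by positivity) hS
    obtain ⟨v, hv⟩ := hne
    obtain ⟨B, hB, hB'⟩ := hC v hv
    obtain ⟨S', hS', hn, hI⟩ := ih (S \ insert v B) (by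
        have h1 := Finset.le_card_sdiff (insert v B) S
        have h2 := Finset.card_insert_le v B
        rw [mul_add] at hS
        omega) (fun i hi => by
        obtain ⟨B, hB, hB'⟩ := hC i (Finset.sdiff_subset hi)
        exact ⟨B, hB, fun j hj => hB' j (Finset.sdiff_subset hj)⟩)
    have hvS' : ∀ j ∈ S', j ∈ S ∧ j ≠ v ∧ j ∉ B := fun j hj => by
      have := hS' hj
      simp only [Finset.mem_sdiff, Finset.mem_insert, not_or] at this
      exact this
    refine ⟨insert v S', ?_, ?_, ?_⟩
    · exact Finset.insert_subset hv (hS'.trans Finset.sdiff_subset)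
    · rw [Finset.card_insert_of_notMem fun h => (hvS' v h).2.1 rfl]
      omega
    · intro i hi j hj hij hc
      rcases Finset.mem_insert.1 hi with rfl | hi' <;> rcases Finset.mem_insert.1 hj with rfl | hj'
      · exact hij rfl
      · exact (hvS' j hj').2.2 (hB' j (hvS' j hj').1 (Or.inl hc))
      · exact (hvS' i hi').2.2 (hB' i (hvS' i hi').1 (Or.inr hc))
      · exact hI i hi' j hj' hij hc

/-- An equality query is constant off the diagonal of a large principal submatrix. -/
theorem exists_subset_labels_const {ι : Type*} [DecidableEq ι] (f g : ι → ℕ) (n : ℕ) (S : Finset ι)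
    (hS : (4 * n + 1) * n ≤ S.card) :
    ∃ S' ⊆ S, n ≤ S'.card ∧ ((∀ i ∈ S', ∀ j ∈ S', i ≠ j → f i = g j) ∨
      ∀ i ∈ S', ∀ j ∈ S', i ≠ j → f i ≠ g j) := by
  -- Either some fibre of `f` or `g` is large, or every label meets few of the others.
  by_cases hf : ∃ t, 2 * n ≤ (S.filter fun i => f i = t).card
  · obtain ⟨t, ht⟩ := hf
    have hsplit := Finset.card_filter_add_card_filter_not (s := S.filter fun i => f i = t)
      (fun j => g j = t)
    rcases le_total n ((S.filter fun i => f i = t).filter fun j => g j = t).card with h | h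
    · refine ⟨_, (Finset.filter_subset _ _).trans (Finset.filter_subset _ _), h, Or.inl ?_⟩
      intro i hi j hj _
      simp only [Finset.mem_filter] at hi hj
      rw [hi.1.2, hj.2]
    · refine ⟨(S.filter fun i => f i = t).filter fun j => ¬ g j = t,
        (Finset.filter_subset _ _).trans (Finset.filter_subset _ _), by omega, Or.inr ?_⟩
      intro i hi j hj _
      simp only [Finset.mem_filter] at hi hj
      rw [hi.1.2]
      exact fun h => hj.2 h.symm
  by_cases hg : ∃ t, 2 * n ≤ (S.filter fun i => g i = t).card
  · obtain ⟨t, ht⟩ := hg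
    have hsplit := Finset.card_filter_add_card_filter_not (s := S.filter fun i => g i = t)
      (fun j => f j = t)
    rcases le_total n ((S.filter fun i => g i = t).filter fun j => f j = t).card with h | h
    · refine ⟨_, (Finset.filter_subset _ _).trans (Finset.filter_subset _ _), h, Or.inl ?_⟩
      intro i hi j hj _
      simp only [Finset.mem_filter] at hi hj
      rw [hi.2, hj.1.2]
    · refine ⟨(S.filter fun i => g i = t).filter fun j => ¬ f j = t,
        (Finset.filter_subset _ _).trans (Finset.filter_subset _ _), by omega, Or.inr ?_⟩
      intro i hi j hj _
      simp only [Finset.mem_filter] at hi hj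
      rw [hj.1.2]
      exact hi.2
  push Not at hf hg
  obtain ⟨S', hS', hn, hI⟩ := exists_independent_subset (fun i j => f i = g j) (4 * n) n S hS
    (fun i _ => ⟨(S.filter fun j => g j = f i) ∪ (S.filter fun j => f j = g i), by
      have := Finset.card_union_le (S.filter fun j => g j = f i) (S.filter fun j => f j = g i)
      have := hf (g i)
      have := hg (f i)
      omega, fun j hj h => by
      simp only [Finset.mem_union, Finset.mem_filter]
      exact h.imp (fun h => ⟨hj, h.symm⟩) (fun h => ⟨hj, h⟩)⟩)
  exact ⟨S', hS', hn, Or.inr hI⟩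

theorem exists_subset_output_const (c n : ℕ) :
    ∃ M : ℕ, ∀ (N K : ℕ) (T : Protocol equality N), T.cost ≤ c →
      ∀ (a b : Fin K → Fin N) (S : Finset (Fin K)), M ≤ S.card →
        ∃ S' ⊆ S, n ≤ S'.card ∧
          ∃ v, ∀ i ∈ S', ∀ j ∈ S', i ≠ j → T.output (a i) (b j) = v := by
  induction c with
  | zero =>
    refine ⟨n, fun N K T hT a b S hS => ?_⟩
    cases T with
    | leaf v => exact ⟨S, subset_rfl, hS, v, fun _ _ _ _ _ => rfl⟩
    | node => simp [Protocol.cost] at hT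
  | succ c ih =>
    obtain ⟨M, hM⟩ := ih
    refine ⟨max n ((4 * M + 1) * M), fun N K T hT a b S hS => ?_⟩
    cases T with
    | leaf v => exact ⟨S, subset_rfl, (le_max_left _ _).trans hS, v, fun _ _ _ _ _ => rfl⟩
    | node Q hQ left right =>
      simp only [Protocol.cost, add_le_add_iff_right, max_le_iff] at hT
      obtain ⟨f, g, hfg⟩ := hQ.exists_labels
      obtain ⟨S₁, hS₁, hc₁, h | h⟩ := exists_subset_labels_const (f ∘ a) (g ∘ b) M S
        ((le_max_right _ _).trans hS)
      · obtain ⟨S₂, hS₂, hn, v, hv⟩ := hM N K right hT.2 a b S₁ hc₁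
        refine ⟨S₂, hS₂.trans hS₁, hn, v, fun i hi j hj hij => ?_⟩
        have hQij : ¬ Q (a i) (b j) = -1 := by
          rw [hfg, not_not]
          exact h i (hS₂ hi) j (hS₂ hj) hij
        rw [Protocol.output, if_neg hQij]
        exact hv i hi j hj hij
      · obtain ⟨S₂, hS₂, hn, v, hv⟩ := hM N K left hT.1 a b S₁ hc₁
        refine ⟨S₂, hS₂.trans hS₁, hn, v, fun i hi j hj hij => ?_⟩
        have hQij : Q (a i) (b j) = -1 := by
          rw [hfg]
          exact h i (hS₂ hi) j (hS₂ hj) hij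
        rw [Protocol.output, if_pos hQij]
        exact hv i hi j hj hij

theorem exists_protocol_of_oracleCost_le {ℬ : CommProblem} {N c : ℕ} {P : SignMatrix N N}
    (h : oracleCost ℬ P ≤ c) : ∃ T : Protocol ℬ N, T.Computes P ∧ T.cost ≤ c := by
  have hlt : oracleCost ℬ P < (c + 1 : ℕ) := lt_of_le_of_lt h (by exact_mod_cast Nat.lt_succ_self c)
  obtain ⟨T, hT⟩ := iInf_lt_iff.1 hlt
  exact ⟨T.1, T.2, Nat.lt_succ_iff.1 (by exact_mod_cast hT)⟩

theorem stable_of_constantCost {𝒢 : GraphClass} (h : ConstantCost equality 𝒢.problem) :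
    𝒢.Stable := by
  obtain ⟨c, hc⟩ := h
  obtain ⟨M, hM⟩ := exists_subset_output_const c 2
  refine ⟨M, fun N G hG => ?_⟩
  by_contra! hlt
  obtain ⟨a, b, -, -, -, hab⟩ := hasChain_chainIndex G
  obtain ⟨T, hT, hTc⟩ := exists_protocol_of_oracleCost_le (P := adj G) (ℬ := equality) (c := c)
    (le_trans (le_iSup₂_of_le (adj G) ⟨G, hG, rfl⟩ le_rfl) (hc N))
  obtain ⟨S, -, hS, v, hv⟩ := hM N _ T hTc a b Finset.univ (by simpa using hlt.le)
  obtain ⟨i, hi, j, hj, hij⟩ := Finset.one_lt_card.1 hS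
  -- The entries `(i, j)` and `(j, i)` of the chain differ, but the protocol cannot tell them apart.
  wlog hlt : i < j generalizing i j
  · exact this j hj i hi hij.symm (lt_of_le_of_ne (not_lt.1 hlt) hij.symm)
  have h1 := hv i hi j hj hij
  have h2 := hv j hj i hi hij.symm
  rw [hT] at h1 h2
  have h3 := h1.trans h2.symm
  have h4 : ¬ G.Adj (a j) (b i) := fun h => (hab i j hlt).2 h.symm
  simp [adj, (hab i j hlt).1, h4] at h3


/-! ### Crossing-closed bipartite graphs -/

/-- A bipartite graph drawn with its two sides on two parallel lines: `side` names the line and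
`pos` the position on it (positions may coincide). Whenever two edges cross, at least one of the
two non-crossing pairs formed by their endpoints is an edge as well. -/
structure CrossingBigraph (V : Type) where
  graph : SimpleGraph V
  side : V → Bool
  pos : V → ℝ
  side_ne : ∀ {x y}, graph.Adj x y → side x ≠ side y
  cross : ∀ {x x' y y'}, side x = side x' → side y = side y' → pos x ≤ pos x' → pos y ≤ pos y' →
    graph.Adj x y' → graph.Adj x' y → graph.Adj x y ∨ graph.Adj x' y'

namespace CrossingBigraph

variable {V : Type} (H : CrossingBigraph V)

/-- The induced subgraph on a set of vertices. -/
def restrict (S : Set V) : CrossingBigraph S where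
  graph := H.graph.induce S
  side x := H.side x
  pos x := H.pos x
  side_ne h := H.side_ne h
  cross h₁ h₂ h₃ h₄ h₅ h₆ := H.cross h₁ h₂ h₃ h₄ h₅ h₆

/-- The bipartite complement. Reversing one of the two lines turns crossing pairs into non-crossing
ones, so that the complement is crossing-closed again. -/
def compl : CrossingBigraph V where
  graph :=
    { Adj := fun x y => H.side x ≠ H.side y ∧ ¬ H.graph.Adj x y
      symm := ⟨fun _ _ h => ⟨h.1.symm, fun h' => h.2 h'.symm⟩⟩
      loopless := ⟨fun _ h => h.1 rfl⟩ }
  side := H.side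
  pos x := if H.side x then H.pos x else -H.pos x
  side_ne h := h.1
  cross := by
    rintro x x' y y' hx hy hpx hpy ⟨h₁, h₂⟩ ⟨h₃, h₄⟩
    by_contra! hcon
    have ha : H.graph.Adj x y := by
      by_contra h
      exact hcon.1 ⟨by rwa [hy], h⟩
    have ha' : H.graph.Adj x' y' := by
      by_contra h
      exact hcon.2 ⟨by rwa [← hx], h⟩
    rw [← hx] at hpx
    rw [← hy] at hpy
    have hxy := H.side_ne ha
    cases hsx : H.side x <;> cases hsy : H.side y <;>
      simp only [hsx, hsy, ne_eq, not_true_eq_false, reduceCtorEq, not_false_eq_true, if_true,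
        if_false, Bool.false_eq_true, neg_le_neg_iff] at hxy hpx hpy
    · exact (H.cross hx.symm hy hpx hpy ha' ha).elim h₄ h₂
    · exact (H.cross hx hy.symm hpx hpy ha ha').elim h₂ h₄

theorem compl_adj {x y : V} (h : H.side x ≠ H.side y) :
    H.compl.graph.Adj x y ↔ ¬ H.graph.Adj x y :=
  ⟨fun h' => h'.2, fun h' => ⟨h, h'⟩⟩

/-! ### Ladders -/

/-- A ladder: a sequence of vertices on alternating sides in which two vertices on different sides
are adjacent iff the earlier one is on the side `true`. Ladders are half graphs written as one
sequence; their length is a finer measure than the size of a half graph, as they grow one vertex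
at a time. -/
def IsLadder (l : List V) : Prop :=
  l.Pairwise (fun u v => H.side u ≠ H.side v → (H.graph.Adj u v ↔ H.side u = true)) ∧
    l.IsChain (fun u v => H.side u ≠ H.side v)

/-- All ladders have length at most `n`. -/
def LadderBound (n : ℕ) : Prop :=
  ∀ l, H.IsLadder l → l.length ≤ n

variable {H}

theorem IsLadder.cons {l : List V} (hl : H.IsLadder l) {v : V}
    (hv : ∀ x ∈ l, H.side v ≠ H.side x → (H.graph.Adj v x ↔ H.side v = true))
    (hh : ∀ x ∈ l.head?, H.side v ≠ H.side x) : H.IsLadder (v :: l) :=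
  ⟨List.pairwise_cons.2 ⟨hv, hl.1⟩, List.isChain_cons.2 ⟨hh, hl.2⟩⟩

theorem IsLadder.concat {l : List V} (hl : H.IsLadder l) {v : V}
    (hv : ∀ x ∈ l, H.side x ≠ H.side v → (H.graph.Adj x v ↔ H.side x = true))
    (hh : ∀ x ∈ l.getLast?, H.side x ≠ H.side v) : H.IsLadder (l ++ [v]) := by
  refine ⟨List.pairwise_append.2 ⟨hl.1, List.pairwise_singleton _ _, ?_⟩,
    hl.2.append (List.isChain_singleton _) ?_⟩
  · intro x hx y hy
    rw [List.mem_singleton.1 hy]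
    exact hv x hx
  · intro x hx y hy
    simp only [List.head?_cons, Option.mem_some_iff] at hy
    exact hy ▸ hh x hx

theorem IsLadder.map_val {S : Set V} {l : List S} (hl : (H.restrict S).IsLadder l) :
    H.IsLadder (l.map Subtype.val) :=
  ⟨List.pairwise_map.2 hl.1, (List.isChain_map _).2 hl.2⟩

theorem IsLadder.reverse {l : List V} (hl : H.compl.IsLadder l) : H.IsLadder l.reverse := by
  refine ⟨List.pairwise_reverse.2 (hl.1.imp ?_), List.isChain_reverse.2 (hl.2.imp ?_)⟩
  · intro u v h hne
    have h := h hne.symm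
    rw [H.compl_adj hne.symm] at h
    change ¬ H.graph.Adj u v ↔ H.side u = true at h
    rw [H.graph.adj_comm, ← not_iff_not, h]
    revert hne
    cases H.side u <;> cases H.side v <;> simp
  · exact fun u v h => h.symm

/-- A ladder can be extended by a vertex `p` complete to the vertices of the ladder on the side
`τ`, or by a vertex `q` anticomplete to those on the other side: at its end if `τ = true`, at its
start if `τ = false`. -/
theorem IsLadder.exists_extension {l : List V} (hl : H.IsLadder l) (hne : l ≠ []) {τ : Bool}
    {p q : V} (hp : H.side p = !τ) (hq : H.side q = τ)
    (hpl : ∀ x ∈ l, H.side x = τ → H.graph.Adj x p)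
    (hql : ∀ x ∈ l, H.side x = !τ → ¬ H.graph.Adj x q) :
    ∃ l', H.IsLadder l' ∧ l'.length = l.length + 1 := by
  cases τ with
  | true =>
    obtain hs | hs := Bool.eq_false_or_eq_true (H.side (l.getLast hne))
    · refine ⟨l ++ [p], hl.concat ?_ ?_, by simp⟩
      · intro x hx hne
        have : H.side x = true := by simpa [hp] using hne
        simp [this, hpl x hx this]
      · intro x hx
        rw [List.getLast?_eq_some_getLast hne, Option.mem_some_iff] at hx
        simp [← hx, hs, hp]
    · refine ⟨l ++ [q], hl.concat ?_ ?_, by simp⟩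
      · intro x hx hne
        have : H.side x = false := by simpa [hq] using hne
        simp [this, hql x hx this]
      · intro x hx
        rw [List.getLast?_eq_some_getLast hne, Option.mem_some_iff] at hx
        simp [← hx, hs, hq]
  | false =>
    obtain hs | hs := Bool.eq_false_or_eq_true (H.side (l.head hne))
    · refine ⟨q :: l, hl.cons ?_ ?_, by simp⟩
      · intro x hx hne
        have : H.side x = true := by simpa [hq] using hne
        simp [hq, H.graph.adj_comm q, hql x hx this]
      · intro x hx
        rw [List.head?_eq_some_head hne, Option.mem_some_iff] at hx
        simp [← hx, hs, hq]
    · refine ⟨p :: l, hl.cons ?_ ?_, by simp⟩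
      · intro x hx hne
        have : H.side x = false := by simpa [hp] using hne
        simp [hp, H.graph.adj_comm p, hpl x hx this]
      · intro x hx
        rw [List.head?_eq_some_head hne, Option.mem_some_iff] at hx
        simp [← hx, hs, hp]

theorem IsLadder.side_getElem {l : List V} (hl : H.IsLadder l) (i : ℕ) (hi : i < l.length) :
    H.side l[i] = (H.side (l[0]'(by omega)) ^^ decide (i % 2 = 1)) := by
  induction i with
  | zero => simp
  | succ i ih =>
    have h1 := List.isChain_iff_getElem.1 hl.2 i hi
    have h2 := ih (by omega)
    rw [h2] at h1
    rcases Nat.mod_two_eq_zero_or_one i with h | h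
    · have h' : (i + 1) % 2 = 1 := by omega
      simp only [h, h'] at h1 ⊢
      revert h1
      cases H.side l[0] <;> cases H.side l[i + 1] <;> simp
    · have h' : (i + 1) % 2 = 0 := by omega
      simp only [h, h'] at h1 ⊢
      revert h1
      cases H.side l[0] <;> cases H.side l[i + 1] <;> simp

/-! ### Distance levels -/

variable (H)

/-- The components of the graph with chosen roots, and the distances from these roots. Two
vertices are in the same component iff they have the same root. The root is the leftmost vertex of
its component on its own side, which is `σ` unless the component has no edges. -/
structure Levels (σ : Bool) where
  root : V → V
  depth : V → ℕ
  root_eq : ∀ {x y}, H.graph.Adj x y → root x = root y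
  depth_le : ∀ {x y}, H.graph.Adj x y → depth y ≤ depth x + 1
  eq_root : ∀ {x}, depth x = 0 → x = root x
  exists_parent : ∀ {x n}, depth x = n + 1 → ∃ y, H.graph.Adj x y ∧ depth y = n
  pos_root_le : ∀ {x}, H.side (root x) = H.side x → H.pos (root x) ≤ H.pos x
  side_root : ∀ {x}, depth x ≠ 0 → H.side (root x) = σ

theorem exists_levels [Finite V] (σ : Bool) : Nonempty (H.Levels σ) := by
  have hroot : ∀ C : H.graph.ConnectedComponent, ∃ r ∈ C.supp,
      (∀ x ∈ C.supp, H.side r = H.side x → H.pos r ≤ H.pos x) ∧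
      ((∃ x ∈ C.supp, H.side x = σ) → H.side r = σ) := by
    intro C
    by_cases h : ∃ x ∈ C.supp, H.side x = σ
    · obtain ⟨r, ⟨hr, hr'⟩, hmin⟩ := Set.exists_min_image {x | x ∈ C.supp ∧ H.side x = σ} H.pos
        (Set.toFinite _) h
      exact ⟨r, hr, fun x hx hs => hmin x ⟨hx, hs.symm.trans hr'⟩, fun _ => hr'⟩
    · obtain ⟨r, hr, hmin⟩ := Set.exists_min_image C.supp H.pos (Set.toFinite _) C.nonempty_supp
      exact ⟨r, hr, fun x hx _ => hmin x hx, fun h' => absurd h' h⟩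
  choose r hr hmin hσ using hroot
  have hreach : ∀ x, H.graph.Reachable (r (H.graph.connectedComponentMk x)) x := fun x =>
    SimpleGraph.ConnectedComponent.exact (hr (H.graph.connectedComponentMk x))
  have hcomp : ∀ {x y}, H.graph.Adj x y →
      H.graph.connectedComponentMk x = H.graph.connectedComponentMk y := fun h =>
    SimpleGraph.ConnectedComponent.sound h.reachable
  have hparent : ∀ {x n}, H.graph.dist (r (H.graph.connectedComponentMk x)) x = n + 1 →
      ∃ y, H.graph.Adj x y ∧ H.graph.dist (r (H.graph.connectedComponentMk y)) y = n := by
    intro x n hx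
    obtain ⟨p, hp⟩ := (hreach x).exists_walk_length_eq_dist
    have hnil : ¬ p.Nil := by
      rw [← SimpleGraph.Walk.length_eq_zero_iff]
      omega
    have hadj := p.adj_penultimate hnil
    refine ⟨_, hadj.symm, ?_⟩
    rw [hcomp hadj]
    have h1 := SimpleGraph.dist_le p.dropLast
    rw [SimpleGraph.Walk.length_dropLast] at h1
    have h2 := hadj.diff_dist_adj (u := r (H.graph.connectedComponentMk x))
    omega
  refine ⟨⟨fun x => r (H.graph.connectedComponentMk x),
    fun x => H.graph.dist (r (H.graph.connectedComponentMk x)) x, fun h => by rw [hcomp h], ?_, ?_,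
    hparent, fun {x} => hmin _ x rfl, ?_⟩⟩
  · intro x y h
    rw [hcomp h]
    have := h.diff_dist_adj (u := r (H.graph.connectedComponentMk y))
    omega
  · intro x h
    exact ((hreach x).dist_eq_zero_iff.1 h).symm
  · intro x h
    obtain ⟨n, hn⟩ := Nat.exists_eq_succ_of_ne_zero h
    obtain ⟨y, hy, -⟩ := hparent hn
    refine hσ _ ?_
    by_cases hs : H.side x = σ
    · exact ⟨x, rfl, hs⟩
    · refine ⟨y, (hcomp hy).symm, ?_⟩
      have := H.side_ne hy
      revert hs this
      cases H.side x <;> cases H.side y <;> cases σ <;> simp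

namespace Levels

variable {H} {σ : Bool} (L : H.Levels σ)

theorem side_eq_root_iff (x : V) : H.side x = H.side (L.root x) ↔ L.depth x % 2 = 0 := by
  induction h : L.depth x generalizing x with
  | zero =>
    have := congrArg H.side (L.eq_root h)
    simp [← this]
  | succ n ih =>
    obtain ⟨y, hy, hd⟩ := L.exists_parent h
    have h1 := ih y hd
    rw [← L.root_eq hy] at h1
    have h2 : H.side x = H.side (L.root x) ↔ ¬ H.side y = H.side (L.root x) := by
      have := H.side_ne hy
      revert this
      cases H.side x <;> cases H.side y <;> cases H.side (L.root x) <;> simp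
    rw [h2, h1]
    omega

theorem side_eq_iff {x y : V} (h : L.root x = L.root y) :
    H.side x = H.side y ↔ L.depth x % 2 = L.depth y % 2 := by
  have h1 := L.side_eq_root_iff x
  have h2 := L.side_eq_root_iff y
  rw [h] at h1
  have h3 : H.side x = H.side y ↔
      (H.side x = H.side (L.root y) ↔ H.side y = H.side (L.root y)) := by
    cases H.side x <;> cases H.side y <;> cases H.side (L.root y) <;> simp
  rw [h3, h1, h2]
  omega

theorem depth_ne {x y : V} (h : H.graph.Adj x y) : L.depth x ≠ L.depth y := fun h' =>
  H.side_ne h ((L.side_eq_iff (L.root_eq h)).2 (by rw [h']))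

end Levels

variable {H}

variable (H) in
/-- `x` lies weakly to the left of the edge `uw` in the drawing on two lines. -/
def LeftOf (u w x : V) : Prop :=
  (H.side x = H.side u → H.pos x ≤ H.pos u) ∧ (H.side x = H.side w → H.pos x ≤ H.pos w)

variable (H) in
/-- `x` lies weakly to the right of the edge `uw` in the drawing on two lines. -/
def RightOf (u w x : V) : Prop :=
  (H.side x = H.side u ∧ H.pos u ≤ H.pos x) ∨ (H.side x = H.side w ∧ H.pos w ≤ H.pos x)

theorem rightOf_of_not_leftOf {u w x : V} (h : ¬ H.LeftOf u w x) : H.RightOf u w x := by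
  by_contra hr
  simp only [RightOf, not_or, not_and, not_le] at hr
  exact h ⟨fun hs => (hr.1 hs).le, fun hs => (hr.2 hs).le⟩

/-- An edge leading from the right of the edge `uw` to its left is joined to it. -/
theorem adj_of_rightOf_of_leftOf {u w x y : V} (huw : H.graph.Adj u w) (hxy : H.graph.Adj x y)
    (hx : H.RightOf u w x) (hy : H.LeftOf u w y) :
    H.graph.Adj x u ∨ H.graph.Adj x w ∨ H.graph.Adj y u ∨ H.graph.Adj y w := by
  have h1 := H.side_ne huw
  have h2 := H.side_ne hxy
  rcases hx with ⟨hs, hp⟩ | ⟨hs, hp⟩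
  · have hyw : H.side y = H.side w := by
      revert h1 h2 hs
      cases H.side u <;> cases H.side w <;> cases H.side x <;> cases H.side y <;> simp
    rcases H.cross hs.symm hyw hp (hy.2 hyw) huw hxy with h | h
    · exact Or.inr (Or.inr (Or.inl h.symm))
    · exact Or.inr (Or.inl h)
  · have hyu : H.side y = H.side u := by
      revert h1 h2 hs
      cases H.side u <;> cases H.side w <;> cases H.side x <;> cases H.side y <;> simp
    rcases H.cross hyu hs.symm (hy.1 hyu) hp hxy.symm huw with h | h
    · exact Or.inr (Or.inr (Or.inr h))
    · exact Or.inl h.symm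

namespace Levels

variable {σ : Bool} (L : H.Levels σ) {u w x p : V}

theorem leftOf_of_depth_eq_zero (huw : H.graph.Adj u w) (hx : L.depth x = 0)
    (hr : L.root x = L.root u) : H.LeftOf u w x := by
  have hxu : x = L.root u := (L.eq_root hx).trans hr
  constructor <;> intro hs
  · rw [hxu] at hs ⊢
    exact L.pos_root_le hs
  · rw [hxu, L.root_eq huw] at hs ⊢
    exact L.pos_root_le hs

/-- The root lies to the left of every edge `uw`, and a path of smaller depth which misses the
neighbourhoods of `u` and `w` cannot pass to the right of this edge. -/
theorem leftOf_of_depth_add_two_le (huw : H.graph.Adj u w) (hd : L.depth w = L.depth u + 1)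
    (hr : L.root x = L.root u) (hx : L.depth x + 2 ≤ L.depth u) : H.LeftOf u w x := by
  induction h : L.depth x generalizing x with
  | zero => exact L.leftOf_of_depth_eq_zero huw h hr
  | succ n ih =>
    obtain ⟨y, hxy, hy⟩ := L.exists_parent h
    have hyl := ih ((L.root_eq hxy).symm.trans hr) (by omega) hy
    by_contra hxl
    have hxr := rightOf_of_not_leftOf hxl
    rcases adj_of_rightOf_of_leftOf huw hxy hxr hyl with h' | h' | h' | h' <;>
    · have := L.depth_le h'
      omega

theorem adj_of_not_leftOf (huw : H.graph.Adj u w) (hd : L.depth w = L.depth u + 1)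
    (hr : L.root x = L.root u) (hx : L.depth x + 1 = L.depth u) (hxl : ¬ H.LeftOf u w x) :
    H.graph.Adj u x := by
  cases h : L.depth x with
  | zero => exact absurd (L.leftOf_of_depth_eq_zero huw h hr) hxl
  | succ n =>
    obtain ⟨y, hxy, hy⟩ := L.exists_parent h
    have hyl := L.leftOf_of_depth_add_two_le huw hd ((L.root_eq hxy).symm.trans hr) (by omega)
    rcases adj_of_rightOf_of_leftOf huw hxy (rightOf_of_not_leftOf hxl) hyl with h' | h' | h' | h'
    · exact h'.symm
    all_goals
      have := L.depth_le h'
      omega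

/-- The path from `x` to the root runs from the right of the edge `uw` to its left, hence meets the
neighbourhood of `u` or `w`; by their depths, only two edges come into question. -/
theorem adj_parent_or_adj (huw : H.graph.Adj u w) (hd : L.depth w = L.depth u + 1)
    (hr : L.root x = L.root u) (hx : L.depth x = L.depth u) (hpos : H.pos u ≤ H.pos x)
    (hp : H.graph.Adj x p) (hpd : L.depth p + 1 = L.depth u) :
    H.graph.Adj u p ∨ H.graph.Adj x w := by
  by_cases hpl : H.LeftOf u w p
  · have hs : H.side x = H.side u := (L.side_eq_iff hr).2 (by rw [hx])
    rcases adj_of_rightOf_of_leftOf huw hp (Or.inl ⟨hs, hpos⟩) hpl with h' | h' | h' | h'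
    · exact absurd hs (H.side_ne h')
    · exact Or.inr h'
    · exact Or.inl h'.symm
    · have := L.depth_le h'
      omega
  · exact Or.inl (L.adj_of_not_leftOf huw hd ((L.root_eq hp).symm.trans hr) hpd hpl)

end Levels

theorem IsLadder.hasChain {W : Type*} {G : SimpleGraph W} {l : List V} (hl : H.IsLadder l) {k : ℕ}
    (hk : 2 * k + 1 ≤ l.length) {ι : V → W} (hinj : Function.Injective ι)
    (hι : ∀ x y, H.side x ≠ H.side y → (H.graph.Adj x y ↔ G.Adj (ι x) (ι y))) : HasChain G k := by
  -- The ladder from its first vertex on the side `true` onwards.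
  obtain ⟨s, hs, hs'⟩ : ∃ s ≤ 1, ∀ i (hi : i < l.length), H.side l[i] = decide (i % 2 = s) := by
    obtain h | h := Bool.eq_false_or_eq_true (H.side (l[0]'(by omega)))
    · refine ⟨0, by simp, fun i hi => ?_⟩
      rw [hl.side_getElem, h]
      rcases Nat.mod_two_eq_zero_or_one i with h | h <;> simp [h]
    · refine ⟨1, by simp, fun i hi => ?_⟩
      rw [hl.side_getElem, h]
      simp
  have hadj : ∀ (i j : ℕ) (hi : i < l.length) (hj : j < l.length), i < j → i % 2 ≠ j % 2 →
      (G.Adj (ι l[i]) (ι l[j]) ↔ i % 2 = s) := fun i j hi hj hij hne => by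
    have hside : H.side l[i] ≠ H.side l[j] := by
      rw [hs', hs', ne_eq, decide_eq_decide]
      omega
    rw [← hι _ _ hside, List.pairwise_iff_getElem.1 hl.1 i j hi hj hij hside, hs',
      decide_eq_true_eq]
  have hlen : ∀ i : Fin k, 2 * (i : ℕ) + s + 1 < l.length := fun i => by
    have := i.2
    omega
  have hab : ∀ i j : Fin k, i ≤ j →
      G.Adj (ι (l[2 * (i : ℕ) + s]'(by have := hlen i; omega)))
        (ι (l[2 * (j : ℕ) + s + 1]'(hlen j))) :=
    fun i j hij => (hadj _ _ _ _ (by have : (i : ℕ) ≤ j := hij; omega) (by omega)).2 (by omega)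
  have hba : ∀ i j : Fin k, i < j → ¬ G.Adj (ι (l[2 * (i : ℕ) + s + 1]'(hlen i)))
      (ι (l[2 * (j : ℕ) + s]'(by have := hlen j; omega))) := fun i j hij h => by
    have : (i : ℕ) < j := hij
    have := (hadj _ _ _ _ (by omega) (by omega)).1 h
    omega
  refine ⟨fun i => ι (l[2 * (i : ℕ) + s]'(by have := hlen i; omega)),
    fun i => ι (l[2 * (i : ℕ) + s + 1]'(hlen i)), ?_, ?_, ?_, fun i j hij =>
    ⟨hab i j hij.le, hba i j hij⟩⟩
  · refine Function.Injective.of_lt_imp_ne fun i j hij h => hba i j hij ?_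
    have := (hab i i le_rfl).symm
    rwa [h] at this
  · refine Function.Injective.of_lt_imp_ne fun i j hij h => hba i j hij ?_
    have := (hab j j le_rfl).symm
    rwa [← h] at this
  · rw [Set.disjoint_left]
    rintro _ ⟨i, rfl⟩ ⟨j, h⟩
    have h := congrArg H.side (hinj h)
    rw [hs', hs', decide_eq_decide] at h
    omega

/-! ### Equality trees from ladder bounds -/

/-- Every finite crossing-closed bipartite graph with ladders of length at most `n` has an equality
tree of depth `c` for adjacency. -/
def TreeBound (n c : ℕ) : Prop :=
  ∀ (V : Type) [Finite V] (H : CrossingBigraph V), H.LadderBound n →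
    EqTree c (fun _ _ => True) H.graph.Adj

variable [Finite V] {n c : ℕ} {A B : Set V}

theorem TreeBound.rect (hc : TreeBound n c)
    (h : ∀ l, H.IsLadder l → (∀ x ∈ l, x ∈ A ∪ B) → l.length ≤ n) :
    EqTree c (fun x y => x ∈ A ∧ y ∈ B) H.graph.Adj := by
  refine EqTree.of_subtype (S := A ∪ B) (fun x y h => ⟨Or.inl h.1, Or.inr h.2⟩) ?_
  refine (hc _ (H.restrict (A ∪ B)) fun l hl => ?_).mono_domain fun _ _ _ => trivial
  have := h _ hl.map_val fun x hx => by
    obtain ⟨y, -, rfl⟩ := List.mem_map.1 hx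
    exact y.2
  simpa using this

/-- If `p` and `q` extend all ladders in `A ∪ B`, then the ladders there are shorter than the
longest ones of the whole graph. -/
theorem TreeBound.rect_of_extension (hc : TreeBound n c) (hn : H.LadderBound (n + 1)) {τ : Bool}
    {p q : V} (hp : H.side p = !τ) (hq : H.side q = τ)
    (hpA : ∀ x ∈ A ∪ B, H.side x = τ → H.graph.Adj x p)
    (hqA : ∀ x ∈ A ∪ B, H.side x = !τ → ¬ H.graph.Adj x q) :
    EqTree c (fun x y => x ∈ A ∧ y ∈ B) H.graph.Adj := by
  refine hc.rect fun l hl hlA => ?_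
  by_cases hne : l = []
  · simp [hne]
  · obtain ⟨l', hl', hlen⟩ := hl.exists_extension hne hp hq (fun x hx => hpA x (hlA x hx))
      (fun x hx => hqA x (hlA x hx))
    have := hn l' hl'
    omega

/-- Two consecutive levels, neither of them next to the root. Let `u` be the rightmost vertex of
the upper level and `p` its parent. Every edge `xy` between the two levels has `x` adjacent to `p`
or `y` adjacent to `u`, and in either of the two cases the ladders can be extended. -/
theorem TreeBound.consecutive_levels (hc : TreeBound n c) (hn : H.LadderBound (n + 1)) {σ : Bool}
    (L : H.Levels σ) (t : V) (i : ℕ) :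
    EqTree (c + 2) (fun x y => (L.root x = t ∧ L.depth x = i + 2) ∧
      (L.root y = t ∧ L.depth y = i + 3)) H.graph.Adj := by
  by_cases hU : ∃ x, L.root x = t ∧ L.depth x = i + 2
  swap
  · exact EqTree.of_forall fun x y h => absurd ⟨x, h.1⟩ hU
  obtain ⟨u, ⟨hut, hud⟩, hmax⟩ := Set.exists_max_image {x | L.root x = t ∧ L.depth x = i + 2} H.pos
    (Set.toFinite _) hU
  obtain ⟨p, hup, hpd⟩ := L.exists_parent hud
  obtain ⟨q, hpq, hqd⟩ := L.exists_parent hpd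
  have hpt : L.root p = t := (L.root_eq hup).symm.trans hut
  have hqt : L.root q = t := (L.root_eq hpq).symm.trans hpt
  have hps : H.side p = !H.side u := by
    have := H.side_ne hup
    revert this
    cases H.side u <;> cases H.side p <;> simp
  have hqs : H.side q = H.side u := (L.side_eq_iff (hqt.trans hut.symm)).2 (by omega)
  have hsU : ∀ x, L.root x = t → L.depth x = i + 2 → H.side x = H.side u := fun x hx hd =>
    (L.side_eq_iff (hx.trans hut.symm)).2 (by omega)
  have hsW : ∀ x, L.root x = t → L.depth x = i + 3 → H.side x ≠ H.side u := fun x hx hd h => by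
    have := (L.side_eq_iff (hx.trans hut.symm)).1 h
    omega
  refine EqTree.of_left (fun x => H.graph.Adj x p) (EqTree.succ ?_)
    (EqTree.of_right (fun y => H.graph.Adj y u) ?_ ?_)
  · refine (hc.rect_of_extension hn (τ := H.side u) (p := p) (q := q)
      (A := {x | (L.root x = t ∧ L.depth x = i + 2) ∧ H.graph.Adj x p})
      (B := {y | L.root y = t ∧ L.depth y = i + 3}) hps hqs ?_ ?_).mono_domain
      fun x y h => ⟨⟨h.1.1, h.2⟩, h.1.2⟩
    · rintro x (hx | hx) hs
      · exact hx.2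
      · exact absurd hs (hsW x hx.1 hx.2)
    · rintro x (hx | hx) hs hadj
      · simp [hsU x hx.1.1 hx.1.2] at hs
      · have h1 := L.depth_le hadj.symm
        have h2 : L.depth x = i + 3 := hx.2
        omega
  · refine (hc.rect_of_extension hn (τ := !H.side u) (p := u) (q := p)
      (A := {x | (L.root x = t ∧ L.depth x = i + 2) ∧ ¬ H.graph.Adj x p})
      (B := {y | (L.root y = t ∧ L.depth y = i + 3) ∧ H.graph.Adj y u})
      (Bool.not_not _).symm hps ?_ ?_).mono_domain
      fun x y h => ⟨⟨h.1.1.1, h.1.2⟩, h.1.1.2, h.2⟩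
    · rintro x (hx | hx) hs
      · simp [hsU x hx.1.1 hx.1.2] at hs
      · exact hx.2
    · rintro x (hx | hx) hs
      · exact hx.2
      · rw [Bool.not_not] at hs
        exact absurd hs (hsW x hx.1.1 hx.1.2)
  · refine EqTree.of_forall_not ?_
    rintro x y ⟨⟨⟨⟨hxt, hxd⟩, -, hyd⟩, hxp⟩, hyu⟩ hxy
    rcases L.adj_parent_or_adj hxy (by omega) (hut.trans hxt.symm) (hud.trans hxd.symm)
      (hmax x ⟨hxt, hxd⟩) hup (by omega) with h | h
    · exact hxp h
    · exact hyu h.symm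

/-- Splitting along distance levels leaves only the pairs of levels at distances `1` and `2` from
the root. -/
theorem TreeBound.of_neighbors (hc : TreeBound n c) (hn : H.LadderBound (n + 1)) (σ : Bool) {c' : ℕ}
    (hcc' : c + 2 ≤ c') (h : ∀ (r : V) (A B : Set V), H.side r = σ → (∀ x ∈ A, H.graph.Adj x r) →
      (∀ x ∈ B, H.side x = σ) → EqTree c' (fun x y => x ∈ A ∧ y ∈ B) H.graph.Adj) :
    EqTree (c' + 3) (fun _ _ => True) H.graph.Adj := by
  obtain ⟨L⟩ := H.exists_levels σ
  have hblock : ∀ t : V × ℕ, EqTree c' (fun x y => (L.root x, L.depth x + 1) = t ∧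
      (L.root y, L.depth y) = t) H.graph.Adj := by
    rintro ⟨v, m⟩
    rcases m with _ | _ | _ | i
    · exact EqTree.of_forall fun x y h => by simp at h
    · refine EqTree.of_forall fun x y h => ?_
      simp only [Prod.mk.injEq] at h
      obtain ⟨z, hyz, hz⟩ := L.exists_parent h.2.2
      have hzx : z = x := by
        rw [L.eq_root hz, L.eq_root (x := x) (by omega), ← L.root_eq hyz, h.1.1, h.2.1]
      exact hzx ▸ hyz.symm
    · by_cases hA : ∃ x, L.root x = v ∧ L.depth x = 1
      · obtain ⟨x₀, hx₀, hd₀⟩ := hA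
        have hv : H.side v = σ := by
          rw [← hx₀]
          exact L.side_root (by omega)
        refine (h v {x | L.root x = v ∧ L.depth x = 1} {y | L.root y = v ∧ L.depth y = 2} hv
          ?_ ?_).mono_domain ?_
        · rintro x ⟨hx, hd⟩
          obtain ⟨z, hxz, hz⟩ := L.exists_parent hd
          have hzv : z = v := by rw [L.eq_root hz, ← L.root_eq hxz, hx]
          exact hzv ▸ hxz
        · rintro y ⟨hy, hd⟩
          rw [(L.side_eq_root_iff y).2 (by omega), hy, hv]
        · intro x y h
          simp only [Prod.mk.injEq] at h
          exact ⟨⟨h.1.1, by omega⟩, h.2.1, by omega⟩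
      · refine EqTree.of_forall fun x y h => ?_
        simp only [Prod.mk.injEq] at h
        exact absurd ⟨x, h.1.1, by omega⟩ hA
    · refine ((hc.consecutive_levels hn L v i).mono hcc').mono_domain fun x y h => ?_
      simp only [Prod.mk.injEq] at h
      exact ⟨⟨h.1.1, by omega⟩, h.2.1, by omega⟩
  have hdown : EqTree (c' + 1) (fun x y => (L.root x, L.depth x + 1) = (L.root y, L.depth y))
      H.graph.Adj :=
    (EqTree.of_blocks (D := fun _ _ => True) _ _
      fun t => (hblock t).mono_domain fun x y h => h.2).mono_domain fun x y h => ⟨trivial, h⟩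
  refine ⟨V × ℕ, fun x => (L.root x, L.depth x + 1), fun y => (L.root y, L.depth y),
    (hdown.mono_domain fun x y h => h.2).succ, V × ℕ, fun x => (L.root x, L.depth x),
    fun y => (L.root y, L.depth y + 1), ?_, EqTree.of_forall_not ?_⟩
  · exact hdown.swap.congr (fun x y h => h.2.symm) fun x y _ => H.graph.adj_comm x y
  · rintro x y ⟨⟨-, h1⟩, h2⟩ hxy
    simp only [ne_eq, Prod.mk.injEq, L.root_eq hxy, true_and] at h1 h2
    have h3 := L.depth_le hxy
    have h4 := L.depth_le hxy.symm
    have h5 := L.depth_ne hxy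
    omega

theorem TreeBound.of_getLast (hc : TreeBound n c) (hn : H.LadderBound (n + 1))
    (h : ∀ l (hl : l ≠ []), H.IsLadder l → H.side (l.getLast hl) = false → l.length ≤ n) :
    EqTree (c + 5) (fun _ _ => True) H.graph.Adj := by
  refine hc.of_neighbors hn false le_rfl fun r A B hr hA hB => ?_
  refine (hc.rect fun l hl hlAB => ?_).mono (Nat.le_add_right _ _)
  by_cases hne : l = []
  · simp [hne]
  obtain hs | hs := Bool.eq_false_or_eq_true (H.side (l.getLast hne))
  · -- A ladder ending on the side opposite to `r` is extended by `r`.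
    have hl' : H.IsLadder (l ++ [r]) := by
      refine hl.concat (fun x hx hxr => ?_) fun x hx => ?_
      · have hxt : H.side x = true := by simpa [hr] using hxr
        rcases hlAB x hx with h | h
        · simp [hxt, hA x h]
        · simp [hB x h] at hxt
      · rw [List.getLast?_eq_some_getLast hne, Option.mem_some_iff] at hx
        simp [← hx, hs, hr]
    have := h _ (by simp) hl' (by simpa using hr)
    simp only [List.length_append, List.length_singleton] at this
    omega
  · exact h l hne hl hs

/-- Passing from ladder length `n` to `n + 1`. The levels at distances `1` and `2` from a root on
the side `true` are treated in the bipartite complement, where they are split along levels again,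
now with roots on the side `false`. -/
theorem TreeBound.succ (hc : TreeBound n c) : TreeBound (n + 1) (c + 8) := by
  intro V _ H hn
  refine hc.of_neighbors hn true (c' := c + 5) (by omega) fun r A B hr hA hB => ?_
  have hadd : ∀ l : List ↥(A ∪ B), (H.restrict (A ∪ B)).compl.IsLadder l →
      H.IsLadder (l.reverse.map Subtype.val) := fun l hl => hl.reverse.map_val
  have htree : EqTree (c + 5) (fun _ _ => True) (H.restrict (A ∪ B)).compl.graph.Adj := by
    refine hc.of_getLast (fun l hl => by simpa using hn _ (hadd l hl)) fun l hne hl hs => ?_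
    -- The reversed ladder starts on the side of `A`, whose vertices are all adjacent to `r`.
    have hl' : H.IsLadder (r :: l.reverse.map Subtype.val) := by
      refine (hadd l hl).cons (fun x hx hxr => ?_) fun x hx => ?_
      · obtain ⟨⟨x, hxAB⟩, -, rfl⟩ := List.mem_map.1 hx
        have hxf : H.side x = false := by simpa [hr] using hxr
        rcases hxAB with h | h
        · simp [hr, (hA x h).symm]
        · simp [hB x h] at hxf
      · rw [List.head?_map, List.head?_reverse, List.getLast?_eq_some_getLast hne,
          Option.map_some, Option.mem_some_iff] at hx
        have hs' : H.side (l.getLast hne).val = false := hs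
        simp [← hx, hr, hs']
    have := hn _ hl'
    simpa using this
  refine EqTree.of_subtype (S := A ∪ B) (fun x y h => ⟨Or.inl h.1, Or.inr h.2⟩) ?_
  refine htree.neg.congr (fun _ _ _ => trivial) fun x y hxy => ?_
  have hs : H.side x ≠ H.side y := by
    have := H.side_ne (hA x hxy.1)
    rwa [hr, ← hB y hxy.2] at this
  rw [(H.restrict (A ∪ B)).compl_adj hs, not_not]
  rfl

theorem treeBound (n : ℕ) : TreeBound n (8 * n) := by
  induction n with
  | zero =>
    intro V _ H hn
    refine EqTree.of_forall fun x y _ => ?_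
    have := hn [x] ⟨List.pairwise_singleton _ _, List.isChain_singleton _⟩
    simp at this
  | succ n ih => exact ih.succ

end CrossingBigraph

/-! ### Unit disk graphs -/

/-- Points `a`, `a'` lie weakly below `b`, `b'`, in this order from left to right. If `ab'` and
`a'b` are at distance less than `2`, then so are `ab` or `a'b'`. In other words, the upper arcs of
two circles of the same radius cross at most once. -/
theorem dist_lt_of_crossing {a₁ a₂ a'₁ a'₂ b₁ b₂ b'₁ b'₂ : ℝ} (ha : a₁ ≤ a'₁) (hb : b₁ ≤ b'₁)
    (h₁ : a₂ ≤ b₂) (h₂ : a₂ ≤ b'₂) (h₃ : a'₂ ≤ b₂) (h₄ : a'₂ ≤ b'₂)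
    (hab' : (a₁ - b'₁) ^ 2 + (a₂ - b'₂) ^ 2 < 4) (ha'b : (a'₁ - b₁) ^ 2 + (a'₂ - b₂) ^ 2 < 4) :
    (a₁ - b₁) ^ 2 + (a₂ - b₂) ^ 2 < 4 ∨ (a'₁ - b'₁) ^ 2 + (a'₂ - b'₂) ^ 2 < 4 := by
  -- Reflection in a vertical line exchanges `a` with `a'` and `b` with `b'`.
  wlog h : a₂ ≤ a'₂ generalizing a₁ a₂ a'₁ a'₂ b₁ b₂ b'₁ b'₂
  · refine (this (a₁ := -a'₁) (a'₁ := -a₁) (b₁ := -b'₁) (b'₁ := -b₁) (neg_le_neg ha) (neg_le_neg hb)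
      h₄ h₃ h₂ h₁ ?_ ?_ (not_le.1 h).le).symm.imp ?_ ?_
    · convert ha'b using 1; ring
    · convert hab' using 1; ring
    · intro h; convert h using 1; ring
    · intro h; convert h using 1; ring
  by_contra! hcon
  obtain ⟨hc, hc'⟩ := hcon
  -- `b` is nearer to `a'` than to `a`, whereas `b'` is nearer to `a` than to `a'`; `m` is the
  -- midpoint of `a` and `a'`.
  obtain ⟨m₁, hm₁⟩ : ∃ m, m = (a₁ + a'₁) / 2 := ⟨_, rfl⟩
  obtain ⟨m₂, hm₂⟩ : ∃ m, m = (a₂ + a'₂) / 2 := ⟨_, rfl⟩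
  have hB : 0 < (a'₁ - a₁) * (b₁ - m₁) + (a'₂ - a₂) * (b₂ - m₂) := by
    subst hm₁ hm₂
    nlinarith
  have hB' : (a'₁ - a₁) * (b'₁ - m₁) + (a'₂ - a₂) * (b'₂ - m₂) < 0 := by
    subst hm₁ hm₂
    nlinarith
  have hpos : 0 ≤ (a'₂ - a₂) * (b'₂ - m₂) := mul_nonneg (by linarith) (by linarith)
  have hleft : b'₁ < m₁ := by
    by_contra! hle
    have := mul_nonneg (sub_nonneg.2 ha) (sub_nonneg.2 hle)
    linarith
  have hup : b'₂ < b₂ := by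
    by_contra! hle
    have h5 := mul_le_mul_of_nonneg_left (sub_le_sub_right hle m₂) (sub_nonneg.2 h)
    have h6 := mul_le_mul_of_nonneg_left (sub_le_sub_right hb m₁) (sub_nonneg.2 ha)
    linarith
  -- Hence `b` is further than `b'` from `a'` in both coordinates.
  have h7 : (a'₁ - b'₁) ^ 2 ≤ (a'₁ - b₁) ^ 2 := pow_le_pow_left₀ (by linarith) (by linarith) 2
  have h8 : (a'₂ - b'₂) ^ 2 ≤ (a'₂ - b₂) ^ 2 := by
    rw [← neg_sq (a'₂ - b'₂), ← neg_sq (a'₂ - b₂)]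
    exact pow_le_pow_left₀ (by linarith) (by linarith) 2
  linarith

/-- Points with coordinates `(u x, v x)`, those on the side `true` weakly below the others; points
on different sides are adjacent if their distance is less than `2`. -/
def CrossingBigraph.ofPoints {V : Type} (u v : V → ℝ) (side : V → Bool)
    (h : ∀ x y, side x = true → side y = false → v x ≤ v y) : CrossingBigraph V where
  graph :=
    { Adj := fun x y => side x ≠ side y ∧ (u x - u y) ^ 2 + (v x - v y) ^ 2 < 4
      symm := ⟨fun x y h => ⟨h.1.symm, by convert h.2 using 1; ring⟩⟩
      loopless := ⟨fun _ h => h.1 rfl⟩ }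
  side := side
  pos := u
  side_ne h := h.1
  cross := by
    rintro x x' y y' hx hy hux huy ⟨hxy', h1⟩ ⟨hx'y, h2⟩
    have hxy : side x ≠ side y := by rwa [hy]
    have hx'y' : side x' ≠ side y' := by rwa [← hx]
    refine Or.imp (fun h => ⟨hxy, h⟩) (fun h => ⟨hx'y', h⟩) ?_
    cases hsx : side x with
    | true =>
      have hsy : side y = false := by simpa [hsx] using hxy
      have hsx' : side x' = true := hx ▸ hsx
      have hsy' : side y' = false := hy ▸ hsy
      exact dist_lt_of_crossing hux huy (h _ _ hsx hsy) (h _ _ hsx hsy') (h _ _ hsx' hsy)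
        (h _ _ hsx' hsy') h1 h2
    | false =>
      have hsy : side y = true := by simpa [hsx] using hxy
      have hsx' : side x' = false := hx ▸ hsx
      have hsy' : side y' = true := hy ▸ hsy
      have := dist_lt_of_crossing huy hux (h _ _ hsy hsx) (h _ _ hsy hsx') (h _ _ hsy' hsx)
        (h _ _ hsy' hsx') (by convert h2 using 1; ring) (by convert h1 using 1; ring)
      exact this.imp (fun h => by convert h using 1; ring) (fun h => by convert h using 1; ring)

/-- Adjacency between two different horizontal strips of height `1`. -/
theorem eqTree_strips {V : Type} [Finite V] {G : SimpleGraph V} {u v : V → ℝ}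
    (hG : ∀ x y, x ≠ y → (G.Adj x y ↔ (u x - u y) ^ 2 + (v x - v y) ^ 2 < 4)) {K : ℕ}
    (hK : ¬ HasChain G (K + 1)) (i j : ℤ) (hij : i ≠ j) :
    EqTree (8 * (2 * K + 2)) (fun x y => ⌊v x⌋ = i ∧ ⌊v y⌋ = j) G.Adj := by
  have hne : ∀ {x y : V}, decide (⌊v x⌋ = min i j) ≠ decide (⌊v y⌋ = min i j) → x ≠ y := by
    rintro x _ h rfl
    exact h rfl
  let H : CrossingBigraph {x | ⌊v x⌋ = i ∨ ⌊v x⌋ = j} := .ofPoints (fun x => u x) (fun x => v x)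
    (fun x => decide (⌊v x⌋ = min i j)) fun x y hx hy => by
      simp only [decide_eq_true_eq, decide_eq_false_iff_not] at hx hy
      have hx' : ⌊v x⌋ + 1 ≤ ⌊v y⌋ := by
        have := y.2
        rw [Set.mem_ofPred_eq] at this
        omega
      have h1 := Int.lt_floor_add_one (v x)
      have h2 := Int.floor_le (v y)
      have h3 : ((⌊v x⌋ + 1 : ℤ) : ℝ) ≤ ⌊v y⌋ := by exact_mod_cast hx'
      push_cast at h3
      linarith
  have hH : ∀ x y, H.side x ≠ H.side y → (H.graph.Adj x y ↔ G.Adj x y) := fun x y h =>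
    ⟨fun h' => (hG _ _ (hne h)).2 h'.2, fun h' => ⟨h, (hG _ _ (hne h)).1 h'⟩⟩
  have htree := CrossingBigraph.treeBound (2 * K + 2) _ H fun l hl => by
    by_contra! hlen
    exact hK (hl.hasChain (by omega) Subtype.val_injective hH)
  refine EqTree.of_subtype (fun x y h => ⟨Or.inl h.1, Or.inr h.2⟩)
    (htree.congr (fun _ _ _ => trivial) fun x y h => (hH x y fun h' => ?_).symm)
  have h' : decide (⌊v x⌋ = min i j) = decide (⌊v y⌋ = min i j) := h'
  rw [decide_eq_decide, h.1, h.2] at h'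
  omega

theorem floor_sub_mem_of_sq_lt {a b r : ℝ} (hr : 0 ≤ r) (h : (a - b) ^ 2 + r < 4) :
    ∃ k ∈ [0, 1, -1, 2, -2], ⌊b⌋ = ⌊a⌋ + k := by
  have habs : |a - b| < 2 := abs_lt_of_sq_lt_sq (by linarith) (by norm_num)
  rw [abs_lt] at habs
  have h1 : ⌊b⌋ ≤ ⌊a⌋ + 2 := by
    rw [← Int.floor_add_ofNat]
    exact Int.floor_le_floor (by linarith)
  have h2 : ⌊a⌋ ≤ ⌊b⌋ + 2 := by
    rw [← Int.floor_add_ofNat]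
    exact Int.floor_le_floor (by linarith)
  refine ⟨⌊b⌋ - ⌊a⌋, ?_, by ring⟩
  simp only [List.mem_cons, List.not_mem_nil, or_false]
  omega

/-- The plane is cut into unit squares. Equality queries find the relative position of the squares
of two points; points in the same square are adjacent, and points in different rows or columns are
handled by `eqTree_strips`. -/
theorem eqTree_of_points {V : Type} [Finite V] {G : SimpleGraph V} {u v : V → ℝ}
    (hG : ∀ x y, x ≠ y → (G.Adj x y ↔ (u x - u y) ^ 2 + (v x - v y) ^ 2 < 4)) {K : ℕ}
    (hK : ¬ HasChain G (K + 1)) :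
    EqTree (8 * (2 * K + 2) + 12) (fun _ _ => True) G.Adj := by
  have hG' : ∀ x y, x ≠ y → (G.Adj x y ↔ (v x - v y) ^ 2 + (u x - u y) ^ 2 < 4) := fun x y h => by
    rw [hG x y h, add_comm]
  refine EqTree.of_offsets (c := 8 * (2 * K + 2) + 6) (fun x => ⌊v x⌋) (fun x => ⌊v x⌋)
    [0, 1, -1, 2, -2] (fun k _ t => ?_)
    (fun x y _ h => floor_sub_mem_of_sq_lt (sq_nonneg _) ((hG' x y h.ne).1 h))
  by_cases hk : k = 0
  swap
  · exact ((eqTree_strips hG hK t (t + k) (by omega)).mono_domain fun x y h => h.2).mono (by omega)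
  refine EqTree.of_offsets (c := 8 * (2 * K + 2)) (fun x => ⌊u x⌋) (fun x => ⌊u x⌋)
    [0, 1, -1, 2, -2] (fun k' _ t' => ?_)
    (fun x y _ h => floor_sub_mem_of_sq_lt (sq_nonneg _) ((hG x y h.ne).1 h))
  by_cases hk' : k' = 0
  swap
  · exact (eqTree_strips hG' hK t' (t' + k') (by omega)).mono_domain fun x y h => h.2
  subst hk hk'
  have hcell : EqTree 1 (fun x y => (True ∧ ⌊v x⌋ = t ∧ ⌊v y⌋ = t + 0) ∧
      ⌊u x⌋ = t' ∧ ⌊u y⌋ = t' + 0) G.Adj := by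
    refine ⟨V, id, id, Or.inr fun x y h hxy => hxy.ne h.2, Or.inl fun x y h => ?_⟩
    obtain ⟨⟨⟨-, hv, hv'⟩, hu, hu'⟩, hne⟩ := h
    have h1 := Int.abs_sub_lt_one_of_floor_eq_floor (hv.trans (by rw [hv', add_zero]))
    have h2 := Int.abs_sub_lt_one_of_floor_eq_floor (hu.trans (by rw [hu', add_zero]))
    have h3 := (sq_lt_one_iff_abs_lt_one _).2 h1
    have h4 := (sq_lt_one_iff_abs_lt_one _).2 h2
    exact (hG x y hne).2 (by linarith)
  exact hcell.mono (by omega)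

theorem IsUnitDisk.eqTree {V : Type} [Finite V] {G : SimpleGraph V} (hG : IsUnitDisk G) {K : ℕ}
    (hK : chainIndex G ≤ K) : EqTree (8 * (2 * K + 2) + 12) (fun _ _ => True) G.Adj := by
  obtain ⟨φ, hφ⟩ := hG
  refine eqTree_of_points (u := fun x => φ x 0) (v := fun x => φ x 1)
    (fun x y hne => ?_) fun h => ?_
  · rw [hφ x y hne, EuclideanSpace.norm_eq, Real.sqrt_lt' two_pos]
    simp only [Fin.sum_univ_two, PiLp.sub_apply, Real.norm_eq_abs, sq_abs]
    norm_num
  · have := le_csSup (bddAbove_hasChain G) h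
    change K + 1 ≤ chainIndex G at this
    omega

theorem constantCost_of_stable {𝒢 : GraphClass} (h𝒢 : ∀ n, ∀ G ∈ 𝒢.graphs n, IsUnitDisk G)
    (h : 𝒢.Stable) : ConstantCost equality 𝒢.problem := by
  obtain ⟨K, hK⟩ := h
  refine ⟨8 * (2 * K + 2) + 12, fun N => iSup₂_le ?_⟩
  rintro _ ⟨G, hG, rfl⟩
  obtain ⟨T, hT, hTG⟩ := ((h𝒢 N G hG).eqTree (hK N G hG)).exists_protocol
  have hT' : T.Computes (adj G) := fun x y => hTG x y trivial
  exact (iInf_le _ (⟨T, hT'⟩ : {T : Protocol equality N // T.Computes (adj G)})).trans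
    (by exact_mod_cast hT)

end UnitDiskComm

theorem mainTheorem4 (𝒢 : UnitDiskComm.GraphClass)
    (h𝒢 : ∀ n : ℕ, ∀ G ∈ 𝒢.graphs n, UnitDiskComm.IsUnitDisk G) :
    UnitDiskComm.ConstantCost UnitDiskComm.equality 𝒢.problem ↔ 𝒢.Stable :=
  ⟨UnitDiskComm.stable_of_constantCost, UnitDiskComm.constantCost_of_stable h𝒢⟩
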